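/- Let $\mathfrak{C}$ be a semistrict monoidal 2-category (Gray monoid) with product $\Box$ and unit $\mathbf{I}$, and let $\mathfrak{M}$ be a $\mathfrak{C}$-enriched 2-category with hom objects $\mathfrak{M}[x,y]$ and composition $m$. A 1-morphism $f:x\to y$ in $\mathfrak{M}$ is a 1-morphism $\mathbf{I}\to\mathfrak{M}[x,y]$ in $\mathfrak{C}$; it induces, by composing with it through $m$, the push-forward $f_*:\mathfrak{M}[w,x]\to\mathfrak{M}[w,y]$ and the pullback $f^*:\mathfrak{M}[y,w]\to\mathfrak{M}[x,w]$. Put $A_x:=\mathfrak{M}[x,x]$, and for $f:x\to y$ let $A_f$, with projections $p^f_x:A_f\to A_x$, $p^f_y:A_f\to A_y$ and 2-isomorphism $\varpi_f:f_*\circ p^f_x\simeq f^*\circ p^f_y$, be a 2-fiber product in $\mathfrak{C}$ of $f_*:A_x\to\mathfrak{M}[x,y]$ and $f^*:A_y\to\mathfrak{M}[x,y]$. Theorem. Let $x\xrightarrow{f}y\xrightarrow{g}z$ be composable 1-morphisms in $\mathfrak{M}$, let $A_f$, $A_g$, $A_{g\circ f}$ be 2-fiber products as above, and let $A_f\times_{A_y}A_g$,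 with projections $\mathrm{pr}_1,\mathrm{pr}_2$ and 2-isomorphism $\phi:p^f_y\circ\mathrm{pr}_1\simeq p^g_y\circ\mathrm{pr}_2$, be a 2-fiber product of $p^f_y$ and $p^g_y$ in $\mathfrak{C}$. Then there is a canonical 1-morphism $$\Phi_{f,g}:A_f\times_{A_y}A_g\longrightarrow A_{g\circ f}$$ in $\mathfrak{C}$, induced by the 2-universal property of $A_{g\circ f}$ and the interchanger of the enriched hom functors. Precisely, let $\xi$ be the 2-isomorphism $$(g\circ f)_*\,p^f_x\,\mathrm{pr}_1\simeq g_*f_*\,p^f_x\,\mathrm{pr}_1\simeq g_*f^*\,p^f_y\,\mathrm{pr}_1\simeq f^*g_*\,p^f_y\,\mathrm{pr}_1\simeq f^*g_*\,p^g_y\,\mathrm{pr}_2\simeq f^*g^*\,p^g_z\,\mathrm{pr}_2\simeq(g\circ f)^*\,p^g_z\,\mathrm{pr}_2$$ obtained by pasting $\varpi_f$, the interchanger $g_*f^*\simeq f^*g_*$, $\phi$ and $\varpi_g$ with the canonical 2-isomorphisms $(g\circ f)_*\simeq g_*f_*$ and $(g\circ f)^*\simeq f^*g^*$. Then: 1.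 there are a 1-morphism $\Phi_{f,g}$ as above and 2-isomorphisms $\zeta_x:p^{g\circ f}_x\circ\Phi_{f,g}\simeq p^f_x\circ\mathrm{pr}_1$ and $\zeta_z:p^{g\circ f}_z\circ\Phi_{f,g}\simeq p^g_z\circ\mathrm{pr}_2$ such that $$\xi\circ_2\big(\mathbf{1}_{(g\circ f)_*}\circ_1\zeta_x\big)=\big(\mathbf{1}_{(g\circ f)^*}\circ_1\zeta_z\big)\circ_2\big(\varpi_{g\circ f}\circ_1\mathbf{1}_{\Phi_{f,g}}\big);$$ 2. for any other such triple $(\Phi',\zeta_x',\zeta_z')$ there is a unique 2-isomorphism $\theta:\Phi_{f,g}\simeq\Phi'$ with $\zeta_x'\circ_2(\mathbf{1}_{p^{g\circ f}_x}\circ_1\theta)=\zeta_x$ and $\zeta_z'\circ_2(\mathbf{1}_{p^{g\circ f}_z}\circ_1\theta)=\zeta_z$. -/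

import Mathlib

open CategoryTheory Bicategory

universe w v u t

/-- A semistrict monoidal 2-category (Gray monoid), i.e. a monoid in the monoidal category of strict
2-categories and strict 2-functors with the Gray tensor product, spelled out on a strict 2-category:
every object acts on either side by a strict 2-functor, these actions are strictly associative and
unital, and the exchange law for 1-morphisms holds up to an invertible interchanger.
Strict equalities between morphisms whose sources and targets are equal, but not by definition, are
expressed by heterogeneous equality. -/
class GrayMonoid (C : Type u) [Bicategory.{w, v} C] [Bicategory.Strict C] where
  /-- the product `A ⊠ B` of objects -/
  tensorObj : C → C → C
  /-- the monoidal unit -/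
  unit : C
  /-- `A ⊠ g` for a 1-morphism `g` -/
  lact (A : C) {B B' : C} (g : B ⟶ B') : tensorObj A B ⟶ tensorObj A B'
  /-- `A ⊠ β` for a 2-morphism `β` -/
  lact₂ (A : C) {B B' : C} {g g' : B ⟶ B'} (β : g ⟶ g') : lact A g ⟶ lact A g'
  /-- `f ⊠ B` for a 1-morphism `f` -/
  ract {A A' : C} (f : A ⟶ A') (B : C) : tensorObj A B ⟶ tensorObj A' B
  /-- `α ⊠ B` for a 2-morphism `α` -/
  ract₂ {A A' : C} {f f' : A ⟶ A'} (α : f ⟶ f') (B : C) : ract f B ⟶ ract f' B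
  -- `A ⊠ -` is a strict 2-functor
  lact_id (A B : C) : lact A (𝟙 B) = 𝟙 (tensorObj A B)
  lact_comp (A : C) {B₁ B₂ B₃ : C} (g : B₁ ⟶ B₂) (h : B₂ ⟶ B₃) :
    lact A (g ≫ h) = lact A g ≫ lact A h
  lact₂_id (A : C) {B B' : C} (g : B ⟶ B') : lact₂ A (𝟙 g) = 𝟙 (lact A g)
  lact₂_comp (A : C) {B B' : C} {g₁ g₂ g₃ : B ⟶ B'} (β : g₁ ⟶ g₂) (γ : g₂ ⟶ g₃) :
    lact₂ A (β ≫ γ) = lact₂ A β ≫ lact₂ A γ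
  lact₂_whiskerLeft (A : C) {B₁ B₂ B₃ : C} (g : B₁ ⟶ B₂) {h h' : B₂ ⟶ B₃} (β : h ⟶ h') :
    lact₂ A (g ◁ β) =
      eqToHom (lact_comp A g h) ≫ lact A g ◁ lact₂ A β ≫ eqToHom (lact_comp A g h').symm
  lact₂_whiskerRight (A : C) {B₁ B₂ B₃ : C} {g g' : B₁ ⟶ B₂} (β : g ⟶ g') (h : B₂ ⟶ B₃) :
    lact₂ A (β ▷ h) =
      eqToHom (lact_comp A g h) ≫ lact₂ A β ▷ lact A h ≫ eqToHom (lact_comp A g' h).symm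
  -- `- ⊠ B` is a strict 2-functor
  ract_id (A B : C) : ract (𝟙 A) B = 𝟙 (tensorObj A B)
  ract_comp {A₁ A₂ A₃ : C} (f : A₁ ⟶ A₂) (h : A₂ ⟶ A₃) (B : C) :
    ract (f ≫ h) B = ract f B ≫ ract h B
  ract₂_id {A A' : C} (f : A ⟶ A') (B : C) : ract₂ (𝟙 f) B = 𝟙 (ract f B)
  ract₂_comp {A A' : C} {f₁ f₂ f₃ : A ⟶ A'} (α : f₁ ⟶ f₂) (γ : f₂ ⟶ f₃) (B : C) :
    ract₂ (α ≫ γ) B = ract₂ α B ≫ ract₂ γ B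
  ract₂_whiskerLeft {A₁ A₂ A₃ : C} (f : A₁ ⟶ A₂) {h h' : A₂ ⟶ A₃} (α : h ⟶ h') (B : C) :
    ract₂ (f ◁ α) B =
      eqToHom (ract_comp f h B) ≫ ract f B ◁ ract₂ α B ≫ eqToHom (ract_comp f h' B).symm
  ract₂_whiskerRight {A₁ A₂ A₃ : C} {f f' : A₁ ⟶ A₂} (α : f ⟶ f') (h : A₂ ⟶ A₃) (B : C) :
    ract₂ (α ▷ h) B =
      eqToHom (ract_comp f h B) ≫ ract₂ α B ▷ ract h B ≫ eqToHom (ract_comp f' h B).symm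
  -- strict unitality
  unit_tensor (A : C) : tensorObj unit A = A
  tensor_unit (A : C) : tensorObj A unit = A
  unit_lact {B B' : C} (g : B ⟶ B') : lact unit g ≍ g
  unit_lact₂ {B B' : C} {g g' : B ⟶ B'} (β : g ⟶ g') : lact₂ unit β ≍ β
  ract_unit {A A' : C} (f : A ⟶ A') : ract f unit ≍ f
  ract₂_unit {A A' : C} {f f' : A ⟶ A'} (α : f ⟶ f') : ract₂ α unit ≍ α
  -- strict associativity
  tensor_assoc (A B D : C) : tensorObj (tensorObj A B) D = tensorObj A (tensorObj B D)
  tensor_lact (A B : C) {D D' : C} (h : D ⟶ D') : lact (tensorObj A B) h ≍ lact A (lact B h)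
  tensor_lact₂ (A B : C) {D D' : C} {h h' : D ⟶ D'} (γ : h ⟶ h') :
    lact₂ (tensorObj A B) γ ≍ lact₂ A (lact₂ B γ)
  lact_ract (A : C) {B B' : C} (g : B ⟶ B') (D : C) : ract (lact A g) D ≍ lact A (ract g D)
  lact₂_ract₂ (A : C) {B B' : C} {g g' : B ⟶ B'} (β : g ⟶ g') (D : C) :
    ract₂ (lact₂ A β) D ≍ lact₂ A (ract₂ β D)
  ract_tensor {A A' : C} (f : A ⟶ A') (B D : C) : ract (ract f B) D ≍ ract f (tensorObj B D)
  ract₂_tensor {A A' : C} {f f' : A ⟶ A'} (α : f ⟶ f') (B D : C) :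
    ract₂ (ract₂ α B) D ≍ ract₂ α (tensorObj B D)
  /-- the interchanger -/
  interchanger {A A' B B' : C} (f : A ⟶ A') (g : B ⟶ B') :
    lact A g ≫ ract f B' ≅ ract f B ≫ lact A' g
  -- the interchanger is natural in 2-morphisms
  interchanger_naturality_left {A A' B B' : C} {f f' : A ⟶ A'} (α : f ⟶ f') (g : B ⟶ B') :
    lact A g ◁ ract₂ α B' ≫ (interchanger f' g).hom =
      (interchanger f g).hom ≫ ract₂ α B ▷ lact A' g
  interchanger_naturality_right {A A' B B' : C} (f : A ⟶ A') {g g' : B ⟶ B'} (β : g ⟶ g') :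
    lact₂ A β ▷ ract f B' ≫ (interchanger f g').hom =
      (interchanger f g).hom ≫ ract f B ◁ lact₂ A' β
  -- the interchanger respects identities and composition of 1-morphisms
  interchanger_id_left (A : C) {B B' : C} (g : B ⟶ B') :
    (interchanger (𝟙 A) g).hom =
      eqToHom (by rw [ract_id, ract_id, Strict.comp_id, Strict.id_comp])
  interchanger_id_right {A A' : C} (f : A ⟶ A') (B : C) :
    (interchanger f (𝟙 B)).hom =
      eqToHom (by rw [lact_id, lact_id, Strict.comp_id, Strict.id_comp])
  interchanger_comp_left {A A' A'' B B' : C} (f : A ⟶ A') (f' : A' ⟶ A'') (g : B ⟶ B') :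
    (interchanger (f ≫ f') g).hom =
      eqToHom (by rw [ract_comp, Strict.assoc]) ≫
        (interchanger f g).hom ▷ ract f' B' ≫
          (α_ (ract f B) (lact A' g) (ract f' B')).hom ≫
            ract f B ◁ (interchanger f' g).hom ≫ eqToHom (by rw [ract_comp, Strict.assoc])
  interchanger_comp_right {A A' B B' B'' : C} (f : A ⟶ A') (g : B ⟶ B') (g' : B' ⟶ B'') :
    (interchanger f (g ≫ g')).hom =
      eqToHom (by rw [lact_comp, Strict.assoc]) ≫
        lact A g ◁ (interchanger f g').hom ≫
          (α_ (lact A g) (ract f B') (lact A' g')).inv ≫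
            (interchanger f g).hom ▷ lact A' g' ≫ eqToHom (by rw [lact_comp, Strict.assoc])
  -- the interchanger respects the product with an object
  interchanger_lact (D : C) {A A' B B' : C} (f : A ⟶ A') (g : B ⟶ B') :
    (interchanger (lact D f) g).hom ≍ lact₂ D (interchanger f g).hom
  interchanger_middle {A A' B B' : C} (f : A ⟶ A') (D : C) (g : B ⟶ B') :
    (interchanger (ract f D) g).hom ≍ (interchanger f (lact D g)).hom
  interchanger_ract {A A' B B' : C} (f : A ⟶ A') (g : B ⟶ B') (D : C) :
    (interchanger f (ract g D)).hom ≍ ract₂ (interchanger f g).hom D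

infixr:70 " ⊠ " => GrayMonoid.tensorObj
infixr:82 " ⊠ₗ " => GrayMonoid.lact
infixr:82 " ⊠ₗₗ " => GrayMonoid.lact₂
infixl:83 " ⊠ᵣ " => GrayMonoid.ract
infixl:83 " ⊠ᵣᵣ " => GrayMonoid.ract₂

namespace GrayMonoid

variable {C : Type u} [Bicategory.{w, v} C] [Bicategory.Strict C]

theorem comp_eqToHom_of_heq {X X' Y Y' : C} {f : X ⟶ Y} {f' : X' ⟶ Y'} (hX : X = X')
    (hY : Y = Y') (h : f ≍ f') : f ≫ eqToHom hY = eqToHom hX ≫ f' := by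
  subst hX hY
  obtain rfl := eq_of_heq h
  simp

theorem eqToHom_comp_eqToHom {X Y Z : C} (h : X = Y) (h' : Y = Z) :
    (eqToHom h : X ⟶ Y) ≫ eqToHom h' = eqToHom (h.trans h') := by
  subst h h'
  simp

theorem eqToHom_comp_eqToHom_assoc {X Y Z W : C} (h : X = Y) (h' : Y = Z) (k : Z ⟶ W) :
    (eqToHom h : X ⟶ Y) ≫ eqToHom h' ≫ k = eqToHom (h.trans h') ≫ k := by
  rw [← Strict.assoc, eqToHom_comp_eqToHom]

variable [GrayMonoid C]

theorem lact_eqToHom (A : C) {B B' : C} (h : B = B') :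
    A ⊠ₗ (eqToHom h : B ⟶ B') = eqToHom (congrArg (fun D => A ⊠ D) h) := by
  subst h
  exact lact_id A B

theorem eqToHom_ract {A A' : C} (h : A = A') (B : C) :
    (eqToHom h : A ⟶ A') ⊠ᵣ B = eqToHom (congrArg (fun D => D ⊠ B) h) := by
  subst h
  exact ract_id A B

section

variable {A A' B B' D X : C}

theorem ract_ract_eqToHom (f : A ⟶ A') (h : (A' ⊠ B) ⊠ D = A' ⊠ B ⊠ D) :
    f ⊠ᵣ B ⊠ᵣ D ≫ eqToHom h = eqToHom (tensor_assoc A B D) ≫ f ⊠ᵣ (B ⊠ D) :=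
  comp_eqToHom_of_heq _ _ (ract_tensor f B D)

theorem ract_ract_eqToHom_assoc (f : A ⟶ A') (h : (A' ⊠ B) ⊠ D = A' ⊠ B ⊠ D)
    (k : A' ⊠ B ⊠ D ⟶ X) :
    f ⊠ᵣ B ⊠ᵣ D ≫ eqToHom h ≫ k = eqToHom (tensor_assoc A B D) ≫ f ⊠ᵣ (B ⊠ D) ≫ k := by
  rw [← Strict.assoc, ract_ract_eqToHom, Strict.assoc]

theorem lact_ract_eqToHom (g : B ⟶ B') (h : (A ⊠ B') ⊠ D = A ⊠ B' ⊠ D) :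
    (A ⊠ₗ g) ⊠ᵣ D ≫ eqToHom h = eqToHom (tensor_assoc A B D) ≫ A ⊠ₗ (g ⊠ᵣ D) :=
  comp_eqToHom_of_heq _ _ (lact_ract A g D)

theorem lact_ract_eqToHom_assoc (g : B ⟶ B') (h : (A ⊠ B') ⊠ D = A ⊠ B' ⊠ D)
    (k : A ⊠ B' ⊠ D ⟶ X) :
    (A ⊠ₗ g) ⊠ᵣ D ≫ eqToHom h ≫ k = eqToHom (tensor_assoc A B D) ≫ A ⊠ₗ (g ⊠ᵣ D) ≫ k := by
  rw [← Strict.assoc, lact_ract_eqToHom, Strict.assoc]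

theorem tensor_lact_eqToHom (g : B ⟶ B') (h : (A ⊠ D) ⊠ B' = A ⊠ D ⊠ B') :
    (A ⊠ D) ⊠ₗ g ≫ eqToHom h = eqToHom (tensor_assoc A D B) ≫ A ⊠ₗ D ⊠ₗ g :=
  comp_eqToHom_of_heq _ _ (tensor_lact A D g)

theorem tensor_lact_eqToHom_assoc (g : B ⟶ B') (h : (A ⊠ D) ⊠ B' = A ⊠ D ⊠ B')
    (k : A ⊠ D ⊠ B' ⟶ X) :
    (A ⊠ D) ⊠ₗ g ≫ eqToHom h ≫ k = eqToHom (tensor_assoc A D B) ≫ A ⊠ₗ D ⊠ₗ g ≫ k := by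
  rw [← Strict.assoc, tensor_lact_eqToHom, Strict.assoc]

theorem eqToHom_unit_lact (g : B ⟶ B') :
    eqToHom (unit_tensor B).symm ≫ unit ⊠ₗ g = g ≫ eqToHom (unit_tensor B').symm :=
  (comp_eqToHom_of_heq _ _ (unit_lact g).symm).symm

theorem eqToHom_unit_lact_assoc (g : B ⟶ B') (k : unit ⊠ B' ⟶ X) :
    eqToHom (unit_tensor B).symm ≫ unit ⊠ₗ g ≫ k =
      g ≫ eqToHom (unit_tensor B').symm ≫ k := by
  rw [← Strict.assoc, eqToHom_unit_lact, Strict.assoc]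

theorem eqToHom_ract_unit (f : A ⟶ A') :
    eqToHom (tensor_unit A).symm ≫ f ⊠ᵣ unit = f ≫ eqToHom (tensor_unit A').symm :=
  (comp_eqToHom_of_heq _ _ (ract_unit f).symm).symm

theorem eqToHom_ract_unit_assoc (f : A ⟶ A') (k : A' ⊠ unit ⟶ X) :
    eqToHom (tensor_unit A).symm ≫ f ⊠ᵣ unit ≫ k =
      f ≫ eqToHom (tensor_unit A').symm ≫ k := by
  rw [← Strict.assoc, eqToHom_ract_unit, Strict.assoc]

end

end GrayMonoid

open GrayMonoid

/-- A 2-category enriched over a Gray monoid. Identifications of objects by strict associativity and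
unitality, and of 1-morphisms by strict functoriality, are written `eqToHom`. -/
structure EnrichedTwoCategory (C : Type u) [Bicategory.{w, v} C] [Bicategory.Strict C]
    [GrayMonoid C] where
  /-- the objects -/
  Ob : Type t
  /-- the enriched hom object -/
  hom : Ob → Ob → C
  /-- the enriched unit -/
  j (x : Ob) : (unit : C) ⟶ hom x x
  /-- the enriched composition -/
  m (x y z : Ob) : hom y z ⊠ hom x y ⟶ hom x z
  /-- the left unitor -/
  lam (x y : Ob) : j y ⊠ᵣ hom x y ≫ m x y y ≅ eqToHom (unit_tensor (hom x y))
  /-- the right unitor -/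
  rho (x y : Ob) : hom x y ⊠ₗ j x ≫ m x x y ≅ eqToHom (tensor_unit (hom x y))
  /-- the associator -/
  assoc (x y z w : Ob) :
    m y z w ⊠ᵣ hom x y ≫ m x y w ≅
      eqToHom (tensor_assoc (hom z w) (hom y z) (hom x y)) ≫ hom z w ⊠ₗ m x y z ≫ m x z w
  pentagon (x y z w v : Ob) :
    eqToHom (by simp only [ract_comp, Strict.assoc]) ≫
      ((assoc y z w v).hom ⊠ᵣᵣ hom x y) ▷ m x y v ≫
      eqToHom (by simp only [ract_comp, Strict.assoc]) ≫
      (eqToHom (tensor_assoc (hom w v) (hom z w) (hom y z)) ⊠ᵣ hom x y ≫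
        (hom w v ⊠ₗ m y z w) ⊠ᵣ hom x y) ◁ (assoc x y w v).hom ≫
      eqToHom (by simp only [lact_comp, Strict.assoc, lact_ract_eqToHom_assoc]) ≫
      (eqToHom (tensor_assoc (hom w v) (hom z w) (hom y z)) ⊠ᵣ hom x y ≫
        eqToHom (tensor_assoc (hom w v) (hom z w ⊠ hom y z) (hom x y))) ◁
          (hom w v ⊠ₗₗ (assoc x y z w).hom) ▷ m x w v =
    (m z w v ⊠ᵣ hom y z ⊠ᵣ hom x y) ◁ (assoc x y z v).hom ≫
      eqToHom (by simp only [Strict.assoc, ract_ract_eqToHom_assoc]) ≫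
      eqToHom (tensor_assoc (hom w v ⊠ hom z w) (hom y z) (hom x y)) ◁
        (interchanger (m z w v) (m x y z)).inv ▷ m x z v ≫
      eqToHom (by simp only [Strict.assoc]) ≫
      (eqToHom (tensor_assoc (hom w v ⊠ hom z w) (hom y z) (hom x y)) ≫
        (hom w v ⊠ hom z w) ⊠ₗ m x y z) ◁ (assoc x z w v).hom ≫
      eqToHom (by
        simp only [Strict.assoc, tensor_lact_eqToHom_assoc, lact_comp, lact_eqToHom, eqToHom_ract,
          eqToHom_comp_eqToHom_assoc])
  triangle (x y z : Ob) :
    eqToHom (by simp only [ract_comp, Strict.assoc]) ≫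
      ((rho y z).hom ⊠ᵣᵣ hom x y) ▷ m x y z =
    (hom y z ⊠ₗ j y) ⊠ᵣ hom x y ◁ (assoc x y y z).hom ≫
      eqToHom (by simp only [lact_comp, Strict.assoc, lact_ract_eqToHom_assoc]) ≫
      eqToHom (tensor_assoc (hom y z) unit (hom x y)) ◁
        (hom y z ⊠ₗₗ (lam x y).hom) ▷ m x y z ≫
      eqToHom (by
        simp only [lact_eqToHom, eqToHom_ract, eqToHom_comp_eqToHom_assoc])

namespace EnrichedTwoCategory

variable {C : Type u} [Bicategory.{w, v} C] [Bicategory.Strict C] [GrayMonoid C]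
  (M : EnrichedTwoCategory.{w, v, u, t} C)

/-- 1-morphisms `x ⟶ y` of the underlying 2-category. -/
abbrev Hom (x y : M.Ob) : Type v := (unit : C) ⟶ M.hom x y

variable {M}

/-- The composite `g ∘ f` in the underlying 2-category. -/
def comp {x y z : M.Ob} (f : M.Hom x y) (g : M.Hom y z) : M.Hom x z :=
  eqToHom (unit_tensor (unit : C)).symm ≫ unit ⊠ₗ f ≫ g ⊠ᵣ M.hom x y ≫ M.m x y z

/-- The push-forward `f_* : M[w, x] ⟶ M[w, y]`. -/
def post (w : M.Ob) {x y : M.Ob} (f : M.Hom x y) : M.hom w x ⟶ M.hom w y :=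
  eqToHom (unit_tensor (M.hom w x)).symm ≫ f ⊠ᵣ M.hom w x ≫ M.m w x y

/-- The pullback `f^* : M[y, w] ⟶ M[x, w]`. -/
def pre {x y : M.Ob} (f : M.Hom x y) (w : M.Ob) : M.hom y w ⟶ M.hom x w :=
  eqToHom (tensor_unit (M.hom y w)).symm ≫ M.hom y w ⊠ₗ f ≫ M.m x y w

theorem comp_eq {x y z : M.Ob} (f : M.Hom x y) (g : M.Hom y z) : comp f g = f ≫ post x g := by
  simp only [comp, post, eqToHom_unit_lact_assoc]

/-- `g ∘ (q ∘ p) ≅ (g ∘ q) ∘ p`, for `p`, `q` variable. -/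
def compPostIso {x y z w : M.Ob} (g : M.Hom z w) :
    M.m x y z ≫ post x g ≅ post y g ⊠ᵣ M.hom x y ≫ M.m x y w :=
  eqToIso (by simp only [post, eqToHom_unit_lact_assoc, Strict.assoc]) ≪≫
  whiskerLeftIso (eqToHom (unit_tensor (M.hom y z ⊠ M.hom x y)).symm)
    (whiskerRightIso (interchanger g (M.m x y z)) (M.m x z w)) ≪≫
  eqToIso (by
    simp only [Strict.assoc, ract_ract_eqToHom_assoc, eqToHom_ract, eqToHom_comp_eqToHom_assoc]) ≪≫
  whiskerLeftIso (eqToHom (unit_tensor (M.hom y z)).symm ⊠ᵣ M.hom x y ≫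
    g ⊠ᵣ M.hom y z ⊠ᵣ M.hom x y) (M.assoc x y z w).symm ≪≫
  eqToIso (by simp only [post, ract_comp, Strict.assoc])

/-- `(r ∘ g) ∘ p ≅ r ∘ (g ∘ p)`, for `p`, `r` variable. -/
def preCompIso {x y z w : M.Ob} (g : M.Hom y z) :
    pre g w ⊠ᵣ M.hom x y ≫ M.m x y w ≅ M.hom z w ⊠ₗ post x g ≫ M.m x z w :=
  eqToIso (by simp only [pre, ract_comp, Strict.assoc]) ≪≫
  whiskerLeftIso (eqToHom (tensor_unit (M.hom z w)).symm ⊠ᵣ M.hom x y ≫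
    (M.hom z w ⊠ₗ g) ⊠ᵣ M.hom x y) (M.assoc x y z w) ≪≫
  eqToIso (by
    simp only [post, lact_comp, Strict.assoc, lact_ract_eqToHom_assoc, eqToHom_ract, lact_eqToHom,
      eqToHom_comp_eqToHom_assoc])

/-- `(r ∘ q) ∘ f ≅ r ∘ (q ∘ f)`, for `q`, `r` variable. -/
def compPreIso {x y z w : M.Ob} (f : M.Hom x y) :
    M.m y z w ≫ pre f w ≅ M.hom z w ⊠ₗ pre f z ≫ M.m x z w :=
  eqToIso (by simp only [pre, eqToHom_ract_unit_assoc, Strict.assoc]) ≪≫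
  whiskerLeftIso (eqToHom (tensor_unit (M.hom z w ⊠ M.hom y z)).symm)
    (whiskerRightIso (interchanger (M.m y z w) f).symm (M.m x y w)) ≪≫
  eqToIso (by simp only [Strict.assoc]) ≪≫
  whiskerLeftIso (eqToHom (tensor_unit (M.hom z w ⊠ M.hom y z)).symm ≫
    (M.hom z w ⊠ M.hom y z) ⊠ₗ f) (M.assoc x y z w) ≪≫
  eqToIso (by
    simp only [pre, lact_comp, Strict.assoc, tensor_lact_eqToHom_assoc, lact_eqToHom,
      eqToHom_comp_eqToHom_assoc])

/-- The interchanger of the enriched hom functors, for `f : x ⟶ y` and `g : z ⟶ w`: the square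
on `M[y, z]` with sides `f^*` and `g_*`. -/
def homInterchanger {x y z w : M.Ob} (f : M.Hom x y) (g : M.Hom z w) :
    pre f z ≫ post x g ≅ post y g ≫ pre f w :=
  eqToIso (by simp only [post, eqToHom_unit_lact_assoc, Strict.assoc]) ≪≫
  whiskerLeftIso (eqToHom (unit_tensor (M.hom y z)).symm)
    (whiskerRightIso (interchanger g (pre f z)) (M.m x z w)) ≪≫
  eqToIso (by simp only [Strict.assoc]) ≪≫
  whiskerLeftIso (eqToHom (unit_tensor (M.hom y z)).symm ≫ g ⊠ᵣ M.hom y z)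
    (compPreIso f).symm ≪≫
  eqToIso (by simp only [post, Strict.assoc])

/-- The canonical identification of `(g ∘ f)_*` with `g_* ∘ f_*`. -/
def postComp (w : M.Ob) {x y z : M.Ob} (f : M.Hom x y) (g : M.Hom y z) :
    post w (comp f g) ≅ post w f ≫ post w g :=
  eqToIso (by rw [comp_eq, post]; simp only [ract_comp, Strict.assoc]) ≪≫
  whiskerLeftIso (eqToHom (unit_tensor (M.hom w x)).symm ≫ f ⊠ᵣ M.hom w x)
    (compPostIso g).symm ≪≫
  eqToIso (by simp only [post, Strict.assoc])

/-- The canonical identification of `(g ∘ f)^*` with `f^* ∘ g^*`. -/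
def preComp {x y z : M.Ob} (f : M.Hom x y) (g : M.Hom y z) (w : M.Ob) :
    pre (comp f g) w ≅ pre g w ≫ pre f w :=
  eqToIso (by rw [comp_eq, pre]; simp only [lact_comp, Strict.assoc]) ≪≫
  whiskerLeftIso (eqToHom (tensor_unit (M.hom z w)).symm ≫ M.hom z w ⊠ₗ f)
    (preCompIso g).symm ≪≫
  eqToIso (by simp only [Strict.assoc]) ≪≫
  whiskerLeftIso (eqToHom (tensor_unit (M.hom z w)).symm)
    (whiskerRightIso (interchanger (pre g w) f) (M.m x y w)) ≪≫
  eqToIso (by rw [pre.eq_1 f]; simp only [eqToHom_ract_unit_assoc, Strict.assoc])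

end EnrichedTwoCategory

/-- A 2-fiber product of a cospan `f : X ⟶ Z`, `g : Y ⟶ Z`: a square filled by an invertible
2-morphism, with the 2-universal property. -/
structure TwoFiberProduct {C : Type u} [Bicategory.{w, v} C] {X Y Z : C} (f : X ⟶ Z)
    (g : Y ⟶ Z) where
  /-- the vertex -/
  pt : C
  fst : pt ⟶ X
  snd : pt ⟶ Y
  /-- the 2-isomorphism filling the square -/
  cell : fst ≫ f ≅ snd ≫ g
  exists_lift {A : C} (p : A ⟶ X) (q : A ⟶ Y) (ξ : p ≫ f ≅ q ≫ g) :
    ∃ (k : A ⟶ pt) (ζ₁ : k ≫ fst ≅ p) (ζ₂ : k ≫ snd ≅ q),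
      ζ₁.hom ▷ f ≫ ξ.hom =
        (α_ k fst f).hom ≫ k ◁ cell.hom ≫ (α_ k snd g).inv ≫ ζ₂.hom ▷ g
  existsUnique_lift₂ {A : C} (k l : A ⟶ pt) (γ₁ : k ≫ fst ⟶ l ≫ fst)
    (γ₂ : k ≫ snd ⟶ l ≫ snd)
    (h : γ₁ ▷ f ≫ (α_ l fst f).hom ≫ l ◁ cell.hom ≫ (α_ l snd g).inv =
      (α_ k fst f).hom ≫ k ◁ cell.hom ≫ (α_ k snd g).inv ≫ γ₂ ▷ g) :
    ∃! θ : k ⟶ l, θ ▷ fst = γ₁ ∧ θ ▷ snd = γ₂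

namespace EnrichedTwoCategory

variable {C : Type u} [Bicategory.{w, v} C] [Bicategory.Strict C] [GrayMonoid C]
  {M : EnrichedTwoCategory.{w, v, u, t} C}

/-- A 2-fiber product `A_f` of `f_* : M[x, x] ⟶ M[x, y]` and `f^* : M[y, y] ⟶ M[x, y]`; its
projections are `p_x` and `p_y`. -/
abbrev EndFiberProduct {x y : M.Ob} (f : M.Hom x y) :=
  TwoFiberProduct (post x f) (pre f y)

/-- The pasting over the composite `x ⟶ y ⟶ z` of the squares of `A_f`, of `A_g` and of
`P = A_f ×_{A_y} A_g` with the interchanger of `f^*` and `g_*`. -/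
def pasting {x y z : M.Ob} (f : M.Hom x y) (g : M.Hom y z) (Af : EndFiberProduct f)
    (Ag : EndFiberProduct g) (P : TwoFiberProduct Af.snd Ag.fst) :
    (P.fst ≫ Af.fst) ≫ post x (comp f g) ≅ (P.snd ≫ Ag.snd) ≫ pre (comp f g) z :=
  whiskerLeftIso (P.fst ≫ Af.fst) (postComp x f g) ≪⊗≫
  whiskerLeftIso P.fst (whiskerRightIso Af.cell (post x g)) ≪⊗≫
  whiskerLeftIso (P.fst ≫ Af.snd) (homInterchanger f g) ≪⊗≫
  whiskerRightIso P.cell (post y g ≫ pre f z) ≪⊗≫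
  whiskerLeftIso P.snd (whiskerRightIso Ag.cell (pre f z)) ≪⊗≫
  whiskerLeftIso (P.snd ≫ Ag.snd) (preComp f g z).symm

end EnrichedTwoCategory

/-! The pasting `ξ` is an invertible 2-cell filling a square over the cospan that `Agf` completes,
so the one-dimensional half of the universal property of `Agf` yields `Φ` with its two
2-isomorphisms. The interchanger and the enriched composition enter only in forming this square. The
comparison of two such triples is a fact about 2-fiber products in any bicategory: lifts of one
square are related by a unique compatible 2-isomorphism. The compatibility equations prescribe both
whiskerings of the comparison 2-cell, and the two-dimensional half then supplies exactly one
(`IsLift.existsUnique_hom`). Exchanging the two lifts gives a 2-cell backwards, and it is inverse to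
the first because the projections jointly detect equality of 2-cells (`hom_ext₂`). -/

namespace TwoFiberProduct

variable {C : Type u} [Bicategory.{w, v} C] {X Y Z : C} {f : X ⟶ Z} {g : Y ⟶ Z}
  (P : TwoFiberProduct f g)

/-- `(k, ζ₁, ζ₂)` exhibits `k` as a lift of the square `ξ` to the 2-fiber product. -/
def IsLift {A : C} {p : A ⟶ X} {q : A ⟶ Y} (ξ : p ≫ f ≅ q ≫ g) (k : A ⟶ P.pt)
    (ζ₁ : k ≫ P.fst ≅ p) (ζ₂ : k ≫ P.snd ≅ q) : Prop :=
  ζ₁.hom ▷ f ≫ ξ.hom =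
    (α_ k P.fst f).hom ≫ k ◁ P.cell.hom ≫ (α_ k P.snd g).inv ≫ ζ₂.hom ▷ g

variable {P} {A : C} {p : A ⟶ X} {q : A ⟶ Y} {ξ : p ≫ f ≅ q ≫ g} {k l : A ⟶ P.pt}
  {ζ₁ : k ≫ P.fst ≅ p} {ζ₂ : k ≫ P.snd ≅ q} {ζ₁' : l ≫ P.fst ≅ p} {ζ₂' : l ≫ P.snd ≅ q}

/-- Both 2-cells solve the two-dimensional lifting problem whose data are the whiskerings of `θ'`,
and that problem has only one solution. -/
theorem hom_ext₂ {θ θ' : k ⟶ l} (h₁ : θ ▷ P.fst = θ' ▷ P.fst) (h₂ : θ ▷ P.snd = θ' ▷ P.snd) :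
    θ = θ' := by
  refine (P.existsUnique_lift₂ k l (θ' ▷ P.fst) (θ' ▷ P.snd) ?_).unique ⟨h₁, h₂⟩ ⟨rfl, rfl⟩
  -- Whiskerings of a single 2-cell are always compatible data: this is the exchange law between
  -- `θ'` and `P.cell`.
  rw [associator_naturality_left_assoc, ← whisker_exchange_assoc,
    associator_inv_naturality_left]

/-- The whiskerings of `θ` are forced to be `ζᵢ` followed by the inverse of `ζᵢ'`; these are
compatible because both lifts are measured against the same `ξ`. -/
theorem IsLift.existsUnique_hom (h : P.IsLift ξ k ζ₁ ζ₂) (h' : P.IsLift ξ l ζ₁' ζ₂') :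
    ∃! θ : k ⟶ l, θ ▷ P.fst ≫ ζ₁'.hom = ζ₁.hom ∧ θ ▷ P.snd ≫ ζ₂'.hom = ζ₂.hom := by
  simp only [← Iso.eq_comp_inv]
  refine P.existsUnique_lift₂ k l _ _ ?_
  -- After this postcomposition, `h'` and `h` turn the two sides into the same 2-cell `ζ₁.hom ▷ f ≫
  -- ξ.hom`.
  rw [← cancel_mono (ζ₂'.hom ▷ g)]
  simp only [IsLift] at h h'
  simp only [Category.assoc, comp_whiskerRight, ← h', inv_hom_whiskerRight_assoc,
    inv_hom_whiskerRight, Category.comp_id, h]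

theorem IsLift.existsUnique_iso (h : P.IsLift ξ k ζ₁ ζ₂) (h' : P.IsLift ξ l ζ₁' ζ₂') :
    ∃! θ : k ≅ l, θ.hom ▷ P.fst ≫ ζ₁'.hom = ζ₁.hom ∧ θ.hom ▷ P.snd ≫ ζ₂'.hom = ζ₂.hom := by
  obtain ⟨θ, ⟨h₁, h₂⟩, hu⟩ := h.existsUnique_hom h'
  obtain ⟨η, ⟨h₁', h₂'⟩, -⟩ := h'.existsUnique_hom h
  -- Each round trip, whiskered with a projection, fixes the corresponding invertible `ζ`, hence is
  -- an identity. Uniqueness descends from 2-morphisms, since a 2-isomorphism is determined by its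
  -- `hom`.
  refine ⟨⟨θ, η, hom_ext₂ ?_ ?_, hom_ext₂ ?_ ?_⟩, ⟨h₁, h₂⟩, fun θ' hθ' => Iso.ext (hu _ hθ')⟩
  · simp [← cancel_mono ζ₁.hom, h₁, h₁']
  · simp [← cancel_mono ζ₂.hom, h₂, h₂']
  · simp [← cancel_mono ζ₁'.hom, h₁, h₁']
  · simp [← cancel_mono ζ₂'.hom, h₂, h₂']

end TwoFiberProduct

theorem mainTheorem6 {C : Type u} [Bicategory.{w, v} C] [Bicategory.Strict C] [GrayMonoid C]
    (M : EnrichedTwoCategory.{w, v, u, t} C) {x y z : M.Ob} (f : M.Hom x y) (g : M.Hom y z)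
    (Af : EnrichedTwoCategory.EndFiberProduct f) (Ag : EnrichedTwoCategory.EndFiberProduct g)
    (Agf : EnrichedTwoCategory.EndFiberProduct (EnrichedTwoCategory.comp f g))
    (P : TwoFiberProduct Af.snd Ag.fst) :
    ∃ (Φ : P.pt ⟶ Agf.pt) (ζx : Φ ≫ Agf.fst ≅ P.fst ≫ Af.fst)
      (ζz : Φ ≫ Agf.snd ≅ P.snd ≫ Ag.snd),
      ζx.hom ▷ EnrichedTwoCategory.post x (EnrichedTwoCategory.comp f g) ≫
          (EnrichedTwoCategory.pasting f g Af Ag P).hom =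
        (α_ _ _ _).hom ≫ Φ ◁ Agf.cell.hom ≫ (α_ _ _ _).inv ≫
          ζz.hom ▷ EnrichedTwoCategory.pre (EnrichedTwoCategory.comp f g) z ∧
      ∀ (Φ' : P.pt ⟶ Agf.pt) (ζx' : Φ' ≫ Agf.fst ≅ P.fst ≫ Af.fst)
        (ζz' : Φ' ≫ Agf.snd ≅ P.snd ≫ Ag.snd),
        ζx'.hom ▷ EnrichedTwoCategory.post x (EnrichedTwoCategory.comp f g) ≫
            (EnrichedTwoCategory.pasting f g Af Ag P).hom =
          (α_ _ _ _).hom ≫ Φ' ◁ Agf.cell.hom ≫ (α_ _ _ _).inv ≫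
            ζz'.hom ▷ EnrichedTwoCategory.pre (EnrichedTwoCategory.comp f g) z →
        ∃! θ : Φ ≅ Φ', θ.hom ▷ Agf.fst ≫ ζx'.hom = ζx.hom ∧
          θ.hom ▷ Agf.snd ≫ ζz'.hom = ζz.hom := by
  obtain ⟨Φ, ζx, ζz, h⟩ := Agf.exists_lift _ _ (EnrichedTwoCategory.pasting f g Af Ag P)
  -- Both pasting equations `h` and `h'` are `IsLift` unfolded, for the same square.
  exact ⟨Φ, ζx, ζz, h, fun _ _ _ h' => TwoFiberProduct.IsLift.existsUnique_iso h h'⟩
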